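/- Conventions. Let $V$ be a finite set and let $G$ be an undirected graph on $V$; every vertex is regarded as carrying a self-loop, so the positions of $G$ are the pairs $(i,j)\in V\times V$ with $i=j$ or $i,j$ adjacent. $G$ is chordal if every simple cycle of length at least $4$ has a chord, i.e. an edge of $G$ joining two non-consecutive vertices of the cycle. A partial matrix with pattern $G$ consists of complex entries specified exactly at the positions of $G$; a completion is a full matrix in $\mathbb C^{V\times V}$ with these entries; its specified principal submatrices are the $C[K]$ with $K$ a clique of $G$. A full matrix has sparsity pattern $G$ if all its entries outside the positions of $G$ are $0$, and it is supported on $K\subseteq V$ if all its entries outside $K\times K$ are $0$. A square complex matrix $C$ is semisectorial if $0$ is not an interior point of the numerical range $\{x^*Cx : x^*x=1\}\subset\mathbb C$. Such a matrix is $*$-congruent to a canonical form $$0_k\;\oplus\;\operatorname{diag}(e^{\mathrm i\alpha_1},\dots,e^{\mathrm i\alpha_l})\;\oplus\;\bigoplus_{j=1}^m e^{\mathrm i\gamma}\begin{bmatrix}1&2\\0&1\end{bmatrix},$$ where $\alpha_1,\dots,\alpha_l,\gamma\in\mathbb R$ are determined modulo $2\pi$. A set of phases of $C$ consists of the numbers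 $\alpha_1,\dots,\alpha_l$ and $m$ copies of each of $\gamma\pm\frac{\pi}{2}$, chosen so that all of them lie in an interval of length $\pi$. We say that $C$ is semisectorial with phases in $[\alpha,\beta]$ if it is semisectorial and some set of phases of $C$ lies in $[\alpha,\beta]$; this includes the zero matrix, which has no phases. Statement. Let $G$ be a chordal graph on a finite set $V$, and let $\alpha,\beta\in\mathbb R$ with $0<\beta-\alpha<\pi$. (1) A partial matrix $C$ with pattern $G$ has a completion that is semisectorial with phases in $[\alpha,\beta]$ if and only if, for every clique $K$ of $G$, the specified principal submatrix $C[K]$ is semisectorial with phases in $[\alpha,\beta]$. (2) For a full matrix $C\in\mathbb C^{V\times V}$ with sparsity pattern $G$ the following are equivalent: (a) $C$ is semisectorial with phases in $[\alpha,\beta]$; (b) $C$ is a finite sum of rank-one semisectorial matrices with phases in $[\alpha,\beta]$; (c) $C$ is a finite sum of rank-one semisectorial matrices with phases in $[\alpha,\beta]$, each of which has sparsity pattern $G$; (d) $C$ is a finite sum of rank-one semisectorial matrices with phases in $[\alpha,\beta]$, each of which is supported on some clique of $G$. Here the empty sum is allowed; it equals the zero matrix. -/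

import Mathlib

namespace MatrixPhase

open Matrix

/-! ### Chordal graphs -/

/-- A graph is chordal if every simple cycle `(v₀, …, v_{m-1}, v₀)` of length `m ≥ 4` has a chord,
i.e. there are indices `i < j` with `2 ≤ j - i < m - 1` such that `vᵢ` and `vⱼ` are adjacent. -/
def IsChordal {V : Type*} (G : SimpleGraph V) : Prop :=
  ∀ (v : V) (w : G.Walk v v), w.IsCycle → 4 ≤ w.length →
    ∃ i j : ℕ, j < w.length ∧ i + 2 ≤ j ∧ j + 1 < i + w.length ∧
      G.Adj (w.getVert i) (w.getVert j)

/-! ### Numerical range and phases -/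

/-- The numerical range `{x* C x | x* x = 1}` of a square complex matrix. -/
def numericalRange {n : Type*} [Fintype n] (C : Matrix n n ℂ) : Set ℂ :=
  {z | ∃ x : n → ℂ, star x ⬝ᵥ x = 1 ∧ star x ⬝ᵥ (C *ᵥ x) = z}

/-- `C` is semisectorial if the origin is not an interior point of its numerical range. -/
def IsSemisectorial {n : Type*} [Fintype n] (C : Matrix n n ℂ) : Prop :=
  (0 : ℂ) ∉ interior (numericalRange C)

/-- `*`-congruence `A = T B T*` with `T` nonsingular. The index sets of `A` and `B` may be
different types; they are identified by a bijection (an enumeration of the rows). -/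
def IsCongruent {n p : Type*} [Fintype n] [DecidableEq n]
    (A : Matrix n n ℂ) (B : Matrix p p ℂ) : Prop :=
  ∃ (e : p ≃ n) (T : Matrix n n ℂ), IsUnit T ∧ A = T * B.reindex e e * Tᴴ

/-- The congruence canonical form
`0_k ⊕ diag(e^{i a₁}, …, e^{i a_l}) ⊕ (m copies of e^{iγ} [1 2; 0 1])`. -/
noncomputable def canonicalForm (k l m : ℕ) (a : Fin l → ℝ) (γ : ℝ) :
    Matrix (Fin k ⊕ (Fin l ⊕ (Fin 2 × Fin m))) (Fin k ⊕ (Fin l ⊕ (Fin 2 × Fin m))) ℂ :=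
  fromBlocks 0 0 0
    (fromBlocks (diagonal fun j => Complex.exp (a j * Complex.I)) 0 0
      (blockDiagonal fun _ : Fin m =>
        Complex.exp (γ * Complex.I) • (!![1, 2; 0, 1] : Matrix (Fin 2) (Fin 2) ℂ)))

/-- `s` is a set (with multiplicities) of phases of `C`: for some congruence canonical form of `C`,
`s` consists of `a₁, …, a_l` and of `m` copies of `γ + π/2` and of `γ - π/2`, and all
the values lie in an interval of length `π`. The arguments `aⱼ` and `γ` are only determined
modulo `2π`, so that a matrix has several sets of phases. A zero matrix has only the
empty set of phases. -/
def IsPhases {n : Type*} [Fintype n] [DecidableEq n] (C : Matrix n n ℂ) (s : Multiset ℝ) : Prop :=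
  (∃ (k l m : ℕ) (a : Fin l → ℝ) (γ : ℝ), IsCongruent C (canonicalForm k l m a γ) ∧
    s = Finset.univ.val.map a + Multiset.replicate m (γ + Real.pi / 2)
      + Multiset.replicate m (γ - Real.pi / 2)) ∧
  ∃ θ : ℝ, ∀ φ ∈ s, φ ∈ Set.Icc θ (θ + Real.pi)

/-- `C` is semisectorial with phases bounded by `α` and `β`: it has a set of phases all of which
lie in `[α, β]`. For a zero matrix the bound on the phases is void. -/
def IsPhaseBounded {n : Type*} [Fintype n] [DecidableEq n] (α β : ℝ) (C : Matrix n n ℂ) : Prop :=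
  IsSemisectorial C ∧ ∃ s : Multiset ℝ, IsPhases C s ∧ ∀ φ ∈ s, φ ∈ Set.Icc α β

/-! ### Patterns, partial matrices and completions

A pattern is a simple graph `G`; every vertex is taken to carry a self-loop, so that the
positions of the pattern are the `(i, j)` with `i = j` or `G.Adj i j`. -/

/-- A full matrix has sparsity pattern `G` if its entries outside the pattern vanish. -/
def HasPattern {V : Type*} (G : SimpleGraph V) (C : Matrix V V ℂ) : Prop :=
  ∀ i j, ¬ (i = j ∨ G.Adj i j) → C i j = 0

/-- A full matrix is supported on `K` if its entries outside `K × K` vanish. -/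
def IsSupportedOn {V : Type*} (K : Finset V) (C : Matrix V V ℂ) : Prop :=
  ∀ i j, ¬ (i ∈ K ∧ j ∈ K) → C i j = 0

/-- A partial matrix with pattern `G`: an entry for each position of the pattern, and none at the
other positions. -/
def PartialMatrix {V : Type*} (G : SimpleGraph V) : Type _ :=
  ∀ i j : V, (i = j ∨ G.Adj i j) → ℂ

/-- The full matrix `M` is a completion of the partial matrix `C`. -/
def PartialMatrix.IsCompletion {V : Type*} {G : SimpleGraph V} (C : PartialMatrix G)
    (M : Matrix V V ℂ) : Prop :=
  ∀ (i j : V) (h : i = j ∨ G.Adj i j), M i j = C i j h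

theorem clique_pos {V : Type*} [DecidableEq V] {G : SimpleGraph V} {K : Finset V}
    (hK : G.IsClique K) (i j : K) : (i : V) = j ∨ G.Adj i j := by
  by_cases h : (i : V) = j
  · exact Or.inl h
  · exact Or.inr (hK i.2 j.2 h)

/-- The specified principal submatrix `C[K]` of a partial matrix. The principal submatrices all of
whose entries are specified are those indexed by the cliques of the pattern. -/
def PartialMatrix.principal {V : Type*} [DecidableEq V] {G : SimpleGraph V} (C : PartialMatrix G)
    {K : Finset V} (hK : G.IsClique K) : Matrix K K ℂ :=
  fun i j => C i j (clique_pos hK i j)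

end MatrixPhase

/-!
The sector `{r e^{iθ} | r ≥ 0, α ≤ θ ≤ β}` with `0 < β - α < π` is the cone spanned by the two real
linearly independent numbers `e^{iα}` and `e^{iβ}`. Accordingly, a matrix is semisectorial with
phases in `[α, β]` exactly when it has the form `e^{iα} P + e^{iβ} Q` with `P` and `Q` positive
semidefinite (`isPhaseBounded_iff_exists`): the blocks of size two of the canonical form cannot
occur, since their phases are `π` apart, and conversely `P` and `Q` are simultaneously diagonalized
by a congruence (`PosSemidef.exists_diagonalize_pair`). The matrices `P` and `Q` are determined by
`C`, each entry by the two entries `C i j` and `C j i` alone (`sectorPart`), so they inherit the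
pattern of `C`, and they make sense for partial matrices as well. Both statements thereby reduce to
positive semidefinite matrices.

For these, the tool is Dirac's theorem (`IsChordal.exists_simplicial`): every induced subgraph of a
chordal graph has a simplicial vertex, one whose neighbours form a clique. Eliminating a simplicial
vertex from a positive semidefinite matrix with pattern `G` splits off a matrix `x x*` supported on
a clique and leaves a positive semidefinite matrix with the same pattern on fewer vertices
(`IsChordal.posSemidef_mem_closure`). Adding a simplicial vertex `v` to a completion `M` on the
other vertices is possible because on the neighbours of `v` the specified column is `M y` for some
`y` supported there; filling in the column by `M y` is a congruence up to a nonnegative diagonal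
entry (`IsChordal.exists_posSemidef_completion_on`).
-/

namespace MatrixPhase

open Matrix
open scoped ComplexOrder

/-! ### Simplicial vertices of chordal graphs -/

/-- The graph on all of `V` whose edges are the edges of `G` inside `T`. -/
def edgesWithin {V : Type*} (G : SimpleGraph V) (T : Set V) : SimpleGraph V where
  Adj u v := G.Adj u v ∧ u ∈ T ∧ v ∈ T
  symm := ⟨fun _ _ h => ⟨h.1.symm, h.2.2, h.2.1⟩⟩
  loopless := ⟨fun _ h => G.loopless.irrefl _ h.1⟩

theorem edgesWithin_le {V : Type*} (G : SimpleGraph V) (T : Set V) : edgesWithin G T ≤ G :=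
  fun _ _ h => h.1

theorem edgesWithin_mono {V : Type*} (G : SimpleGraph V) {S T : Set V} (h : S ⊆ T) :
    edgesWithin G S ≤ edgesWithin G T :=
  fun _ _ h' => ⟨h'.1, h h'.2.1, h h'.2.2⟩

/-- In a chordal graph, two neighbours `x`, `y` of `a` that are joined by a path avoiding the closed
neighbourhood of `a` in between are adjacent: a shortest such path, closed up through `a`, would
otherwise be a chordless cycle. -/
theorem IsChordal.adj_of_reachable {V : Type*} {G : SimpleGraph V} (hG : IsChordal G) {a x y : V}
    (hx : G.Adj a x) (hy : G.Adj a y) (hxy : x ≠ y) {T : Set V}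
    (hT : ∀ u ∈ T, u = x ∨ u = y ∨ (u ≠ a ∧ ¬ G.Adj a u))
    (hr : (edgesWithin G T).Reachable x y) : G.Adj x y := by
  by_contra hadj
  obtain ⟨p, hp⟩ := hr.exists_walk_length_eq_dist
  have hpath := p.isPath_of_length_eq_dist hp
  have hlen : 2 ≤ p.length := by
    rw [hp]
    exact hr.one_lt_dist_of_ne_of_not_adj hxy fun h => hadj h.1
  -- every vertex of the path lies in `T`
  have hmem : ∀ k ≤ p.length, p.getVert k ∈ T := by
    intro k hk
    rcases Nat.lt_or_ge k p.length with h | h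
    · exact (p.adj_getVert_succ h).2.1
    · have h1 : k = (k - 1) + 1 := by omega
      rw [h1]
      exact (p.adj_getVert_succ (i := k - 1) (by omega)).2.2
  have hinner : ∀ k, 1 ≤ k → k < p.length → p.getVert k ≠ a ∧ ¬ G.Adj a (p.getVert k) := by
    intro k hk1 hk2
    rcases hT _ (hmem k hk2.le) with h | h | h
    · have := hpath.getVert_injOn (x₁ := k) (x₂ := 0) hk2.le (Nat.zero_le _)
        (by rw [h, SimpleGraph.Walk.getVert_zero])
      omega
    · have := hpath.getVert_injOn (x₁ := k) (x₂ := p.length) hk2.le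
        (Set.mem_ofPred_eq ▸ le_refl p.length)
        (by rw [h, SimpleGraph.Walk.getVert_length])
      omega
    · exact h
  have hna : a ∉ p.support := by
    intro h
    obtain ⟨k, hk, hkl⟩ := SimpleGraph.Walk.mem_support_iff_exists_getVert.1 h
    rcases Nat.eq_zero_or_pos k with rfl | h0
    · rw [SimpleGraph.Walk.getVert_zero] at hk
      exact hx.ne hk.symm
    · rcases hkl.lt_or_eq with h1 | rfl
      · exact (hinner k h0 h1).1 hk
      · rw [SimpleGraph.Walk.getVert_length] at hk
        exact hy.ne hk.symm
  set q := p.mapLe (edgesWithin_le G T) with hq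
  have hqv : ∀ k, q.getVert k = p.getVert k := fun k => by simp [hq, SimpleGraph.Walk.getVert_map]
  have hql : q.length = p.length := by simp [hq]
  have hcyc : (SimpleGraph.Walk.cons hx (q.concat hy.symm)).IsCycle := by
    rw [SimpleGraph.Walk.cons_isCycle_iff]
    refine ⟨((SimpleGraph.Walk.isPath_mapLe _).2 hpath).concat (by simpa [hq] using hna) _, ?_⟩
    rw [SimpleGraph.Walk.edges_concat, List.concat_eq_append, List.mem_append]
    rintro (h | h)
    · exact hna (by simpa [hq] using q.fst_mem_support_of_mem_edges h)
    · simp only [List.mem_singleton, Sym2.eq_iff] at h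
      rcases h with ⟨h, -⟩ | ⟨-, h⟩
      · exact hy.ne h
      · exact hxy h
  -- the positions of the vertices on the cycle
  have hpos : ∀ k ≤ p.length,
      (SimpleGraph.Walk.cons hx (q.concat hy.symm)).getVert (k + 1) = p.getVert k := by
    intro k hk
    rw [SimpleGraph.Walk.getVert_cons_succ, SimpleGraph.Walk.concat_eq_append,
      SimpleGraph.Walk.getVert_append, ← hqv]
    split_ifs with h
    · rfl
    · have : k = q.length := by omega
      subst this
      simp
  obtain ⟨i, j, hj, hij, hji, hchord⟩ := hG a _ hcyc (by simp [hql]; omega)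
  simp only [SimpleGraph.Walk.length_cons, SimpleGraph.Walk.length_concat, hql] at hj hji
  obtain ⟨j, rfl⟩ : ∃ j', j = j' + 1 := ⟨j - 1, by omega⟩
  rw [hpos j (by omega)] at hchord
  rcases Nat.eq_zero_or_pos i with rfl | hi
  · rw [SimpleGraph.Walk.getVert_zero] at hchord
    exact (hinner j (by omega) (by omega)).2 hchord
  · obtain ⟨i, rfl⟩ : ∃ i', i = i' + 1 := ⟨i - 1, by omega⟩
    rw [hpos i (by omega)] at hchord
    have hF : (edgesWithin G T).Adj (p.getVert i) (p.getVert j) :=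
      ⟨hchord, hmem i (by omega), hmem j (by omega)⟩
    -- the chord is a shortcut
    have := SimpleGraph.dist_le ((p.take i).append (SimpleGraph.Walk.cons hF (p.drop j)))
    rw [SimpleGraph.Walk.length_append, SimpleGraph.Walk.length_cons,
      SimpleGraph.Walk.take_length, SimpleGraph.Walk.drop_length, ← hp] at this
    omega

/-- The strengthening of Dirac's theorem that is amenable to induction: in the subgraph induced by
`S`, some simplicial vertex avoids the closed neighbourhood of a given non-universal vertex. -/
theorem IsChordal.exists_simplicial_not_adj {V : Type*} [DecidableEq V] {G : SimpleGraph V}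
    (hG : IsChordal G) (S : Finset V) :
    ∀ a ∈ S, (∃ b ∈ S, b ≠ a ∧ ¬ G.Adj a b) →
      ∃ v ∈ S, v ≠ a ∧ ¬ G.Adj a v ∧ G.IsClique {w | w ∈ S ∧ G.Adj v w} := by
  classical
  induction S using Finset.strongInduction with
  | H S ih =>
  rintro a ha ⟨b, hb, hba, hab⟩
  -- `C` is the component of `b` in `S` without the closed neighbourhood of `a`,
  -- and `X` is the set of vertices of `S` outside `C` with a neighbour in `C`
  set T : Set V := {u | u ∈ S ∧ u ≠ a ∧ ¬ G.Adj a u} with hTdef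
  set C : Finset V := S.filter fun u => u ∈ T ∧ (edgesWithin G T).Reachable b u with hC
  set X : Finset V := S.filter fun u => u ∉ C ∧ ∃ c ∈ C, G.Adj u c with hX
  have hbT : b ∈ T := ⟨hb, hba, hab⟩
  have hbC : b ∈ C := by simp [hC, hb, hbT]
  have hCT : ∀ u ∈ C, u ∈ T := fun u hu => (Finset.mem_filter.1 hu).2.1
  have hXa : ∀ x ∈ X, G.Adj a x := by
    intro x hx
    obtain ⟨hxS, hxC, c, hc, hxc⟩ := Finset.mem_filter.1 hx
    by_contra hax
    have hcT := hCT c hc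
    have hxa : x ≠ a := by
      rintro rfl
      exact hcT.2.2 hxc
    have hxT : x ∈ T := ⟨hxS, hxa, hax⟩
    refine hxC (Finset.mem_filter.2 ⟨hxS, hxT, ?_⟩)
    have hcx : (edgesWithin G T).Adj c x := ⟨hxc.symm, hcT, hxT⟩
    exact (Finset.mem_filter.1 hc).2.2.trans hcx.reachable
  have hXclique : ∀ x ∈ X, ∀ y ∈ X, x ≠ y → G.Adj x y := by
    intro x hx y hy hxy
    obtain ⟨-, -, c, hc, hxc⟩ := Finset.mem_filter.1 hx
    obtain ⟨-, -, d, hd, hyd⟩ := Finset.mem_filter.1 hy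
    have hsub : T ⊆ T ∪ {x, y} := Set.subset_union_left
    refine hG.adj_of_reachable (hXa x hx) (hXa y hy) hxy (T := T ∪ {x, y}) ?_ ?_
    · rintro u (hu | hu | hu)
      · exact Or.inr (Or.inr hu.2)
      · exact Or.inl hu
      · exact Or.inr (Or.inl hu)
    · have h1 : (edgesWithin G (T ∪ {x, y})).Adj x c := ⟨hxc, by simp, hsub (hCT c hc)⟩
      have h2 : (edgesWithin G (T ∪ {x, y})).Adj d y := ⟨hyd.symm, hsub (hCT d hd), by simp⟩
      have h3 : (edgesWithin G T).Reachable c d :=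
        (Finset.mem_filter.1 hc).2.2.symm.trans (Finset.mem_filter.1 hd).2.2
      exact h1.reachable.trans ((h3.mono (edgesWithin_mono G hsub)).trans h2.reachable)
  have hCS : C ∪ X ⊂ S := by
    refine (Finset.ssubset_iff_of_subset (Finset.union_subset (Finset.filter_subset _ _)
      (Finset.filter_subset _ _))).2 ⟨a, ha, fun h => ?_⟩
    rcases Finset.mem_union.1 h with h | h
    · exact (hCT a h).2.1 rfl
    · exact G.loopless.irrefl _ (hXa a h)
  -- neighbours in `S` of a vertex of `C` stay in `C ∪ X`, so it suffices to work there
  suffices h : ∃ v ∈ C, G.IsClique {w | w ∈ C ∪ X ∧ G.Adj v w} by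
    obtain ⟨v, hv, hvc⟩ := h
    have hvT := hCT v hv
    refine ⟨v, hvT.1, hvT.2.1, hvT.2.2, hvc.subset ?_⟩
    rintro w ⟨hwS, hvw⟩
    refine ⟨Finset.mem_union.2 ?_, hvw⟩
    by_cases hwC : w ∈ C
    · exact Or.inl hwC
    · exact Or.inr (Finset.mem_filter.2 ⟨hwS, hwC, v, hv, hvw.symm⟩)
  by_cases h1 : ∃ x ∈ X, ∃ u ∈ C ∪ X, u ≠ x ∧ ¬ G.Adj x u
  · obtain ⟨x, hx, hu⟩ := h1
    obtain ⟨v, hv, hvx, hxv, hvc⟩ := ih _ hCS x (Finset.mem_union_right _ hx) hu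
    refine ⟨v, (Finset.mem_union.1 hv).resolve_right fun hvX => ?_, hvc⟩
    exact hxv (hXclique x hx v hvX hvx.symm)
  · push Not at h1
    by_cases h2 : ∃ c ∈ C, ∃ u ∈ C ∪ X, u ≠ c ∧ ¬ G.Adj c u
    · obtain ⟨c, hc, hu⟩ := h2
      obtain ⟨v, hv, hvc', hcv, hvc⟩ := ih _ hCS c (Finset.mem_union_left _ hc) hu
      refine ⟨v, (Finset.mem_union.1 hv).resolve_right fun hvX => ?_, hvc⟩
      exact hcv (h1 v hvX c (Finset.mem_union_left _ hc) hvc'.symm).symm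
    · push Not at h2
      refine ⟨b, hbC, ?_⟩
      rintro u ⟨hu, -⟩ w ⟨hw, -⟩ huw
      rcases Finset.mem_union.1 hu with h | h
      · exact h2 u h w hw huw.symm
      · exact h1 u h w hw huw.symm

/-- Dirac's theorem: every nonempty induced subgraph of a chordal graph has a simplicial vertex. -/
theorem IsChordal.exists_simplicial {V : Type*} [DecidableEq V] {G : SimpleGraph V}
    (hG : IsChordal G) {S : Finset V} (hS : S.Nonempty) :
    ∃ v ∈ S, G.IsClique {w | w ∈ S ∧ G.Adj v w} := by
  by_cases h : ∃ a ∈ S, ∃ b ∈ S, b ≠ a ∧ ¬ G.Adj a b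
  · obtain ⟨a, ha, hb⟩ := h
    obtain ⟨v, hv, -, -, hvc⟩ := hG.exists_simplicial_not_adj S a ha hb
    exact ⟨v, hv, hvc⟩
  · push Not at h
    obtain ⟨v, hv⟩ := hS
    exact ⟨v, hv, fun u hu w hw huw => h u hu.1 w hw.1 huw.symm⟩

/-! ### Positive semidefinite matrices with a chordal pattern -/

/-- A positive semidefinite matrix is a Gram matrix. -/
theorem exists_gram {n : Type*} [Finite n] {A : Matrix n n ℂ} (hA : A.PosSemidef) :
    ∃ (m : ℕ) (b : n → EuclideanSpace ℂ (Fin m)), ∀ i j, A i j = inner ℂ (b i) (b j) := by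
  obtain ⟨m, v, rfl⟩ := posSemidef_iff_eq_sum_vecMulVec.1 hA
  refine ⟨m, fun i => WithLp.toLp 2 fun k => star (v k i), fun i j => ?_⟩
  rw [EuclideanSpace.inner_toLp_toLp, Matrix.sum_apply]
  simp [vecMulVec_apply, dotProduct, mul_comm]

theorem PosSemidef.apply_eq_zero {n : Type*} [Finite n] {A : Matrix n n ℂ} (hA : A.PosSemidef)
    {v : n} (hv : A v v = 0) (i : n) : A i v = 0 := by
  obtain ⟨m, b, hb⟩ := exists_gram hA
  rw [hb, inner_self_eq_zero] at hv
  rw [hb, hv, inner_zero_right]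

/-- In a positive semidefinite matrix, the column of `v` is on the other rows a combination `y` of
the other columns, and the corresponding Schur complement is nonnegative. In a Gram representation,
`y` gives the orthogonal projection of the vector of `v` onto the span of the others. -/
theorem PosSemidef.exists_mulVec_eq {n : Type*} [Fintype n] [DecidableEq n] {A : Matrix n n ℂ}
    (hA : A.PosSemidef) (v : n) :
    ∃ y : n → ℂ, y v = 0 ∧ (∀ i, i ≠ v → (A *ᵥ y) i = A i v) ∧
      0 ≤ A v v - star y ⬝ᵥ (A *ᵥ y) := by
  obtain ⟨m, b, hb⟩ := exists_gram hA
  set W := Submodule.span ℂ (Set.range fun i => if i = v then 0 else b i) with hW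
  set w := W.starProjection (b v) with hw
  have hwW : w ∈ W := W.starProjection_apply_mem _
  obtain ⟨c, hc⟩ := Submodule.mem_span_range_iff_exists_fun (R := ℂ).1 hwW
  set y : n → ℂ := fun i => if i = v then 0 else c i with hy
  have hyw : ∑ i, y i • b i = w := by
    rw [← hc]
    refine Finset.sum_congr rfl fun i _ => ?_
    by_cases h : i = v <;> simp [hy, h]
  have hmul : ∀ i, (A *ᵥ y) i = inner ℂ (b i) w := by
    intro i
    rw [← hyw, inner_sum]
    simp only [mulVec, dotProduct, hb, inner_smul_right]
    exact Finset.sum_congr rfl fun j _ => mul_comm _ _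
  have horth : ∀ u ∈ W, inner ℂ u (b v - w) = 0 := fun u hu =>
    (inner_eq_zero_symm).1 (W.starProjection_inner_eq_zero _ _ hu)
  refine ⟨y, by simp [hy], fun i hi => ?_, ?_⟩
  · have hbi : b i ∈ W := Submodule.subset_span ⟨i, by simp [hi]⟩
    have := horth _ hbi
    rw [inner_sub_right, sub_eq_zero] at this
    rw [hmul, hb, this]
  · have h1 : star y ⬝ᵥ (A *ᵥ y) = inner ℂ w w := by
      conv_rhs => enter [2]; rw [← hyw]
      rw [sum_inner]
      simp only [dotProduct, hmul, inner_smul_left]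
      rfl
    have h2 : A v v - star y ⬝ᵥ (A *ᵥ y) = inner ℂ (b v - w) (b v - w) := by
      have e1 := horth w hwW
      have e2 := inner_eq_zero_symm.1 e1
      rw [h1, hb]
      simp only [inner_sub_left, inner_sub_right] at e1 e2 ⊢
      linear_combination e1 + e2
    rw [h2, inner_self_eq_norm_sq_to_K, ← RCLike.ofReal_pow]
    exact RCLike.ofReal_nonneg.2 (sq_nonneg _)

/-- A positive semidefinite matrix with a chordal pattern is a sum of matrices `x x*` with `x`
supported on a clique: pivoting at a simplicial vertex creates no fill-in. -/
theorem IsChordal.posSemidef_mem_closure {V : Type*} [Fintype V] [DecidableEq V]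
    {G : SimpleGraph V} (hG : IsChordal G) (S : Finset V) :
    ∀ A : Matrix V V ℂ, A.PosSemidef → HasPattern G A → IsSupportedOn S A →
      A ∈ AddSubmonoid.closure {D : Matrix V V ℂ | ∃ K : Finset V, G.IsClique K ∧
        ∃ x : V → ℂ, x ≠ 0 ∧ (∀ i ∉ K, x i = 0) ∧ D = vecMulVec x (star x)} := by
  classical
  induction S using Finset.strongInduction with
  | H S ih =>
  intro A hA hp hs
  rcases S.eq_empty_or_nonempty with rfl | hne
  · have : A = 0 := by
      ext i j
      exact hs i j (by simp)
    rw [this]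
    exact zero_mem _
  obtain ⟨v, hv, hclique⟩ := hG.exists_simplicial hne
  have hherm : ∀ i j, star (A i j) = A j i := fun i j => by
    conv_rhs => rw [← hA.1]
    rfl
  by_cases h0 : A v v = 0
  · refine ih (S.erase v) (Finset.erase_ssubset hv) A hA hp fun i j hij => ?_
    by_cases hi : i = v
    · rw [hi, ← hherm, PosSemidef.apply_eq_zero hA h0, star_zero]
    by_cases hj : j = v
    · rw [hj, PosSemidef.apply_eq_zero hA h0]
    refine hs i j fun h => hij ?_
    simp [hi, hj, h]
  -- the pivot column, supported on the closed neighbourhood of `v` in `S`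
  obtain ⟨r, hr0, hr⟩ : ∃ r : ℝ, 0 < r ∧ A v v = (r : ℂ) ^ 2 := by
    have h1 : 0 ≤ A v v := hA.diag_nonneg
    rw [Complex.le_def] at h1
    have h2 : A v v = ((A v v).re : ℂ) := Complex.ext rfl (by simpa using h1.2.symm)
    have h3 : 0 < (A v v).re := lt_of_le_of_ne h1.1 fun h => h0 (by rw [h2, ← h]; simp)
    refine ⟨√(A v v).re, Real.sqrt_pos.2 h3, ?_⟩
    rw [← Complex.ofReal_pow, Real.sq_sqrt h3.le]
    exact h2
  have hrC : (r : ℂ) ≠ 0 := by exact_mod_cast hr0.ne'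
  set x : V → ℂ := fun i => (r : ℂ)⁻¹ * A i v with hx
  have hxv : x v = r := by
    simp only [hx, hr]
    field_simp
  set K : Finset V := S.filter fun w => w = v ∨ G.Adj v w with hK
  have hxK : ∀ i ∉ K, x i = 0 := by
    intro i hi
    have : A i v = 0 := by
      by_cases hiS : i ∈ S
      · refine hp i v fun h => hi (Finset.mem_filter.2 ⟨hiS, ?_⟩)
        exact h.imp id fun h => h.symm
      · exact hs i v fun h => hiS h.1
    simp [hx, this]
  have hKc : G.IsClique K := by
    intro i hi j hj hij
    obtain ⟨hiS, hi⟩ := Finset.mem_filter.1 (Finset.mem_coe.1 hi)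
    obtain ⟨hjS, hj⟩ := Finset.mem_filter.1 (Finset.mem_coe.1 hj)
    rcases hi with rfl | hi
    · exact hj.resolve_left hij.symm
    · rcases hj with rfl | hj
      · exact hi.symm
      · exact hclique ⟨hiS, hi⟩ ⟨hjS, hj⟩ hij
  set B := A - vecMulVec x (star x) with hB
  have hBe : ∀ i j, B i j = A i j - x i * star (x j) := fun i j => by
    simp [hB, vecMulVec_apply]
  have hBv : ∀ i, B i v = 0 := by
    intro i
    rw [hBe, hxv]
    simp only [hx, Complex.star_def, Complex.conj_ofReal]
    field_simp
    ring
  have hBpsd : B.PosSemidef := by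
    -- `B` is the congruence of `A` that eliminates the column of `v`
    have key : B = (1 - vecMulVec x (Pi.single v (r : ℂ)⁻¹)) * A *
        (1 - vecMulVec x (Pi.single v (r : ℂ)⁻¹))ᴴ := by
      have h1 : (1 - vecMulVec x (Pi.single v (r : ℂ)⁻¹)) * A = B := by
        rw [sub_mul, one_mul, vecMulVec_mul, hB]
        congr 2
        ext j
        simp only [single_vecMul, Pi.smul_apply, row_apply, smul_eq_mul, hx, Pi.star_apply,
          star_mul', hherm, star_inv₀, Complex.star_def, Complex.conj_ofReal]
      rw [h1, conjTranspose_sub, conjTranspose_one, mul_sub, mul_one, conjTranspose_vecMulVec,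
        mul_vecMulVec]
      have : B *ᵥ star (Pi.single v (r : ℂ)⁻¹) = 0 := by
        ext i
        rw [← Pi.single_star, mulVec_single]
        simp [hBv]
      rw [this, zero_vecMulVec, sub_zero]
    rw [key]
    exact hA.mul_mul_conjTranspose_same _
  have hBherm : ∀ i j, star (B i j) = B j i := fun i j => by
    conv_rhs => rw [← hBpsd.1]
    rfl
  have hBp : HasPattern G B := by
    intro i j hij
    rw [hBe, hp i j hij]
    by_cases hi : i ∈ K
    · by_cases hj : j ∈ K
      · exact absurd (or_iff_not_imp_left.2 fun h => hKc hi hj h) hij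
      · simp [hxK j hj]
    · simp [hxK i hi]
  have hBs : IsSupportedOn (S.erase v) B := by
    intro i j hij
    by_cases hi : i = v
    · rw [hi, ← hBherm, hBv, star_zero]
    by_cases hj : j = v
    · rw [hj, hBv]
    have hij' : ¬ (i ∈ S ∧ j ∈ S) := fun h => hij (by simp [hi, hj, h])
    have hKS : ∀ k ∉ S, x k = 0 := fun k hk => hxK k fun h => hk (Finset.mem_filter.1 h).1
    rw [hBe, hs i j hij']
    by_cases hiS : i ∈ S
    · simp [hKS j fun h => hij' ⟨hiS, h⟩]
    · simp [hKS i hiS]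
  have hsum : A = B + vecMulVec x (star x) := by rw [hB, sub_add_cancel]
  rw [hsum]
  refine add_mem (ih _ (Finset.erase_ssubset hv) B hBpsd hBp hBs)
    (AddSubmonoid.subset_closure ⟨K, hKc, x, fun h => ?_, hxK, rfl⟩)
  exact hrC (by rw [← hxv, h]; rfl)

/-- A partial matrix with a chordal pattern, here given as the restriction of `P` to the pattern,
has a positive semidefinite completion on `S` as soon as its specified principal submatrices are
positive semidefinite: the vertices can be added one at a time, each one simplicial when added. -/
theorem IsChordal.exists_posSemidef_completion_on {V : Type*} [Fintype V] [DecidableEq V]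
    {G : SimpleGraph V} (hG : IsChordal G) {P : Matrix V V ℂ}
    (hP : ∀ K : Finset V, G.IsClique K →
      (P.submatrix ((↑) : K → V) ((↑) : K → V)).PosSemidef) (S : Finset V) :
    ∃ M : Matrix V V ℂ, M.PosSemidef ∧ IsSupportedOn S M ∧
      ∀ i ∈ S, ∀ j ∈ S, i = j ∨ G.Adj i j → M i j = P i j := by
  classical
  induction S using Finset.strongInduction with
  | H S ih =>
  rcases S.eq_empty_or_nonempty with rfl | hne
  · exact ⟨0, PosSemidef.zero, fun _ _ _ => rfl, by simp⟩
  obtain ⟨v, hv, hclique⟩ := hG.exists_simplicial hne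
  obtain ⟨M, hM, hMs, hMP⟩ := ih _ (Finset.erase_ssubset hv)
  set K : Finset V := S.filter fun w => w = v ∨ G.Adj v w with hK
  have hvK : v ∈ K := by simp [hK, hv]
  have hKS : ∀ i ∈ K, i ∈ S := fun i hi => (Finset.mem_filter.1 hi).1
  have hKc : G.IsClique K := by
    intro i hi j hj hij
    obtain ⟨hiS, hi⟩ := Finset.mem_filter.1 (Finset.mem_coe.1 hi)
    obtain ⟨hjS, hj⟩ := Finset.mem_filter.1 (Finset.mem_coe.1 hj)
    rcases hi with rfl | hi
    · exact hj.resolve_left hij.symm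
    · rcases hj with rfl | hj
      · exact hi.symm
      · exact hclique ⟨hiS, hi⟩ ⟨hjS, hj⟩ hij
  have hPK := hP K hKc
  obtain ⟨y', hy'v, hy', hschur⟩ := PosSemidef.exists_mulVec_eq hPK ⟨v, hvK⟩
  have hMherm : ∀ i j, star (M i j) = M j i := fun i j => by
    conv_rhs => rw [← hM.1]
    rfl
  have hMv : ∀ i, M i v = 0 := fun i => hMs i v (by simp)
  have hMv' : ∀ i, M v i = 0 := fun i => hMs v i (by simp)
  set y : V → ℂ := fun i => if h : i ∈ K then y' ⟨i, h⟩ else 0 with hy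
  have hyK : ∀ i : K, y i = y' i := fun i => by simp [hy]
  have hy0 : ∀ i ∉ K, y i = 0 := fun i hi => by simp [hy, hi]
  have hsumK : ∀ f : V → ℂ, (∀ i ∉ K, f i = 0) → ∑ i, f i = ∑ i : K, f i := by
    intro f hf
    rw [Finset.univ_eq_attach, Finset.sum_attach K f]
    exact (Finset.sum_subset (Finset.subset_univ K) fun i _ hi => hf i hi).symm
  have hmul : ∀ i : K, (i : V) ≠ v →
      (M *ᵥ y) i = (P.submatrix ((↑) : K → V) ((↑) : K → V) *ᵥ y') i := by
    intro i hi
    simp only [mulVec, dotProduct]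
    rw [hsumK _ fun j hj => by rw [hy0 j hj, mul_zero]]
    refine Finset.sum_congr rfl fun j _ => ?_
    rw [hyK, submatrix_apply]
    by_cases hj : (j : V) = v
    · have : j = ⟨v, hvK⟩ := Subtype.ext hj
      rw [this, hy'v, mul_zero, mul_zero]
    · rw [hMP i (by simp [hi, hKS i i.2]) j (by simp [hj, hKS j j.2]) (clique_pos hKc i j)]
  have hquad : star y ⬝ᵥ (M *ᵥ y) =
      star y' ⬝ᵥ (P.submatrix ((↑) : K → V) ((↑) : K → V) *ᵥ y') := by
    simp only [dotProduct, Pi.star_apply]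
    rw [hsumK _ fun j hj => by rw [hy0 j hj, star_zero, zero_mul]]
    refine Finset.sum_congr rfl fun j _ => ?_
    rw [hyK]
    by_cases hj : (j : V) = v
    · have : j = ⟨v, hvK⟩ := Subtype.ext hj
      rw [this, hy'v, star_zero, zero_mul, zero_mul]
    · rw [hmul j hj]
  set c := M *ᵥ y with hc
  have hcv : c v = 0 := by simp [hc, mulVec, dotProduct, hMv']
  set e : V → ℂ := Pi.single v 1 with he
  have hes : star e = e := by rw [he, ← Pi.single_star, star_one]
  have hev : e v = 1 := by simp [he]
  have hei : ∀ i, i ≠ v → e i = 0 := fun i hi => by simp [he, hi]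
  -- the column of `v` is filled in by a congruence, its diagonal entry by a nonnegative summand
  set M' := (1 + vecMulVec e (star y)) * M * (1 + vecMulVec e (star y))ᴴ +
    (P v v - star y ⬝ᵥ c) • vecMulVec e (star e) with hM'
  have hM'psd : M'.PosSemidef := by
    refine (hM.mul_mul_conjTranspose_same _).add
      ((posSemidef_vecMulVec_self_star e).smul ?_)
    rw [hquad]
    exact hschur
  have hM'e : ∀ i j, M' i j = M i j + e i * star (c j) + c i * e j + P v v * (e i * e j) := by
    have h1 : star y ᵥ* M = star c := by
      rw [hc, star_mulVec, hM.1]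
    have h2 : (1 + vecMulVec e (star y)) * M * (1 + vecMulVec e (star y))ᴴ =
        M + vecMulVec e (star c) + vecMulVec c e + (star y ⬝ᵥ c) • vecMulVec e e := by
      rw [conjTranspose_add, conjTranspose_one, conjTranspose_vecMulVec, star_star, hes, add_mul,
        one_mul, vecMulVec_mul, h1, mul_add, mul_one, add_mul, mul_vecMulVec, ← hc,
        vecMulVec_mul_vecMulVec]
      have : star c ⬝ᵥ y = star y ⬝ᵥ c := by
        rw [← h1, hc, dotProduct_mulVec]
      rw [this, vecMulVec_smul, add_assoc (M + _)]
    intro i j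
    rw [hM', h2, hes]
    simp only [Matrix.add_apply, Matrix.smul_apply, vecMulVec_apply, Pi.star_apply, smul_eq_mul]
    ring
  have hM'herm : ∀ i j, star (M' i j) = M' j i := fun i j => by
    conv_rhs => rw [← hM'psd.1]
    rfl
  have hcol : ∀ i ∈ S, G.Adj i v → M' i v = P i v := by
    intro i hi hiv
    have hiK : i ∈ K := by simp [hK, hi, hiv.symm]
    rw [hM'e, hMv, hei i hiv.ne, hev, hmul ⟨i, hiK⟩ hiv.ne,
      hy' ⟨i, hiK⟩ fun h => hiv.ne (Subtype.ext_iff.1 h), submatrix_apply]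
    ring
  refine ⟨M', hM'psd, fun i j hij => ?_, fun i hi j hj hij => ?_⟩
  · have hcS : ∀ k ∉ S, c k = 0 := by
      intro k hk
      simp only [hc, mulVec, dotProduct]
      exact Finset.sum_eq_zero fun l _ => by rw [hMs k l (by simp [hk]), zero_mul]
    have heS : ∀ k ∉ S, e k = 0 := fun k hk => hei k fun h => hk (h ▸ hv)
    rw [hM'e, hMs i j fun h => hij ⟨Finset.mem_of_mem_erase h.1, Finset.mem_of_mem_erase h.2⟩]
    by_cases hiS : i ∈ S
    · have hjS : j ∉ S := fun h => hij ⟨hiS, h⟩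
      simp [hcS j hjS, heS j hjS]
    · simp [hcS i hiS, heS i hiS]
  · by_cases hiv : i = v
    · subst hiv
      by_cases hji : j = i
      · subst hji
        rw [hM'e, hMv, hcv, hev]
        simp
      · have hadj : G.Adj i j := hij.resolve_left fun h => hji h.symm
        have hjK : j ∈ K := by simp [hK, hj, hadj]
        have h3 : star (P j i) = P i j :=
          congrFun (congrFun hPK.1 ⟨i, hvK⟩) ⟨j, hjK⟩
        rw [← hM'herm, hcol j hj hadj.symm, h3]
    · by_cases hjv : j = v
      · subst hjv
        exact hcol i hi (hij.resolve_left hiv)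
      · rw [hM'e, hei i hiv, hei j hjv,
          hMP i (by simp [hiv, hi]) j (by simp [hjv, hj]) hij]
        ring

/-! ### Simultaneous diagonalization by congruence -/

theorem exists_unitary_mul_diagonal {n : Type*} [Fintype n] [DecidableEq n] {A : Matrix n n ℂ}
    (hA : A.IsHermitian) : ∃ (U : Matrix n n ℂ) (d : n → ℝ), U * Uᴴ = 1 ∧
      A = U * diagonal (fun i => (d i : ℂ)) * Uᴴ := by
  refine ⟨hA.eigenvectorUnitary, hA.eigenvalues, ?_, ?_⟩
  · exact Unitary.coe_mul_star_self hA.eigenvectorUnitary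
  · have := hA.spectral_theorem
    rw [Unitary.conjStarAlgAut_apply] at this
    exact this

/-- The case of sum `0 ⊕ 1`: both matrices vanish outside the second block, where they add up to the
identity and hence are diagonalized by the same unitary matrix. -/
theorem diagonalize_pair_of_add_eq {n : Type*} [Fintype n] [DecidableEq n] {P Q : Matrix n n ℂ}
    (hP : P.PosSemidef) (hQ : Q.PosSemidef) (z : n → Prop) [DecidablePred z]
    (h : P + Q = diagonal fun i => if z i then 0 else 1) :
    ∃ (T : Matrix n n ℂ) (p q : n → ℝ), IsUnit T ∧
      P = T * diagonal (fun i => (p i : ℂ)) * Tᴴ ∧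
      Q = T * diagonal (fun i => (q i : ℂ)) * Tᴴ := by
  set e := Equiv.sumCompl z with he
  have hzero : ∀ i, z i → P i i = 0 ∧ Q i i = 0 := by
    intro i hi
    have h1 : P i i + Q i i = 0 := by
      rw [← Matrix.add_apply, h, diagonal_apply_eq, if_pos hi]
    exact (add_eq_zero_iff_of_nonneg hP.diag_nonneg hQ.diag_nonneg).1 h1
  have hblock : ∀ A : Matrix n n ℂ, A.PosSemidef → (∀ i, z i → A i i = 0) →
      A.submatrix e e = fromBlocks 0 0 0
        (A.submatrix (Subtype.val : {i // ¬ z i} → n) (Subtype.val : {i // ¬ z i} → n)) := by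
    intro A hA hA0
    have hherm : ∀ i j, star (A i j) = A j i := fun i j => by
      conv_rhs => rw [← hA.1]
      rfl
    ext (i | i) (j | j)
    · simpa [he] using PosSemidef.apply_eq_zero hA (hA0 j j.2) i
    · simpa [he, hherm] using congrArg star (PosSemidef.apply_eq_zero hA (hA0 i i.2) j)
    · simpa [he] using PosSemidef.apply_eq_zero hA (hA0 j j.2) i
    · simp [he]
  set P₁ := P.submatrix (Subtype.val : {i // ¬ z i} → n) (Subtype.val : {i // ¬ z i} → n) with hP₁
  set Q₁ := Q.submatrix (Subtype.val : {i // ¬ z i} → n) (Subtype.val : {i // ¬ z i} → n) with hQ₁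
  have hPQ₁ : Q₁ = 1 - P₁ := by
    rw [eq_sub_iff_add_eq']
    ext i j
    have hij' : P₁ i j + Q₁ i j = (diagonal fun i => if z i then 0 else 1 : Matrix n n ℂ) i j := by
      rw [← h]
      rfl
    rw [Matrix.add_apply, hij']
    by_cases hij : i = j
    · subst hij
      simp [i.2]
    · rw [diagonal_apply_ne _ fun h' => hij (Subtype.ext h'), one_apply_ne hij]
  obtain ⟨W, d, hW, hPW⟩ :=
    exists_unitary_mul_diagonal (hP.submatrix (Subtype.val : {i // ¬ z i} → n)).1
  change P₁ = _ at hPW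
  have hQW : Q₁ = W * diagonal (fun i => ((1 - d i : ℝ) : ℂ)) * Wᴴ := by
    have : diagonal (fun i => ((1 - d i : ℝ) : ℂ)) = 1 - diagonal (fun i => (d i : ℂ)) := by
      rw [← diagonal_one, diagonal_sub]
      simp
    rw [hPQ₁, this, mul_sub, sub_mul, mul_one, hW, ← hPW]
  set T₀ : Matrix ({i // z i} ⊕ {i // ¬ z i}) ({i // z i} ⊕ {i // ¬ z i}) ℂ :=
    fromBlocks 1 0 0 W with hT₀
  have hT₀u : T₀ * T₀ᴴ = 1 := by
    rw [hT₀, fromBlocks_conjTranspose, fromBlocks_multiply]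
    simp [hW]
  have lift : ∀ (A : Matrix n n ℂ) (f : {i // ¬ z i} → ℝ), A.PosSemidef →
      (∀ i, z i → A i i = 0) →
      A.submatrix (Subtype.val : {i // ¬ z i} → n) (Subtype.val : {i // ¬ z i} → n) =
        W * diagonal (fun i => (f i : ℂ)) * Wᴴ →
      A = T₀.submatrix e.symm e.symm *
        diagonal (fun i => ((Sum.elim (fun _ => 0) f (e.symm i) : ℝ) : ℂ)) *
        (T₀.submatrix e.symm e.symm)ᴴ := by
    intro A f hA hA0 hf
    have h1 : diagonal (fun i => ((Sum.elim (fun _ => 0) f (e.symm i) : ℝ) : ℂ)) =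
        (fromBlocks 0 0 0 (diagonal fun i => (f i : ℂ)) : Matrix _ _ ℂ).submatrix e.symm e.symm := by
      have h2 : (fromBlocks 0 0 0 (diagonal fun i => (f i : ℂ)) :
          Matrix ({i // z i} ⊕ {i // ¬ z i}) ({i // z i} ⊕ {i // ¬ z i}) ℂ) =
          diagonal (fun i => ((Sum.elim (fun _ => 0) f i : ℝ) : ℂ)) := by
        ext (i | i) (j | j) <;> simp [diagonal_apply]
      rw [h2, submatrix_diagonal_equiv]
      rfl
    have h3 : A = (A.submatrix e e).submatrix e.symm e.symm := by simp
    rw [h1, conjTranspose_submatrix, submatrix_mul_equiv, submatrix_mul_equiv, h3,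
      hblock A hA hA0, hf, hT₀, fromBlocks_conjTranspose, fromBlocks_multiply, fromBlocks_multiply]
    simp
  refine ⟨T₀.submatrix e.symm e.symm, _, _, ?_, lift P d hP (fun i hi => (hzero i hi).1) hPW,
    lift Q _ hQ (fun i hi => (hzero i hi).2) hQW⟩
  refine IsUnit.of_mul_eq_one (T₀.submatrix e.symm e.symm)ᴴ ?_
  rw [conjTranspose_submatrix, submatrix_mul_equiv, hT₀u, submatrix_one_equiv]

/-- Two positive semidefinite matrices are simultaneously diagonalized by a congruence: one brings
their sum to the form `0 ⊕ 1`, and a unitary congruence of the second block does the rest. -/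
theorem PosSemidef.exists_diagonalize_pair {n : Type*} [Fintype n] [DecidableEq n]
    {P Q : Matrix n n ℂ} (hP : P.PosSemidef) (hQ : Q.PosSemidef) :
    ∃ (T : Matrix n n ℂ) (p q : n → ℝ), IsUnit T ∧ (∀ i, 0 ≤ p i) ∧ (∀ i, 0 ≤ q i) ∧
      P = T * diagonal (fun i => (p i : ℂ)) * Tᴴ ∧
      Q = T * diagonal (fun i => (q i : ℂ)) * Tᴴ := by
  suffices hsuff : ∃ (T : Matrix n n ℂ) (p q : n → ℝ), IsUnit T ∧
      P = T * diagonal (fun i => (p i : ℂ)) * Tᴴ ∧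
      Q = T * diagonal (fun i => (q i : ℂ)) * Tᴴ by
    obtain ⟨T, p, q, hT, hPT, hQT⟩ := hsuff
    have hpos : ∀ (A : Matrix n n ℂ) (f : n → ℝ), A.PosSemidef →
        A = T * diagonal (fun i => (f i : ℂ)) * Tᴴ → ∀ i, 0 ≤ f i := by
      intro A f hA hAT i
      rw [hAT] at hA
      have := (hT.posSemidef_star_right_conjugate_iff).1 hA
      exact Complex.zero_le_real.1 (posSemidef_diagonal_iff.1 this i)
    exact ⟨T, p, q, hT, hpos P p hP hPT, hpos Q q hQ hQT, hPT, hQT⟩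
  have hR := hP.add hQ
  obtain ⟨U, d, hU, hRU⟩ := exists_unitary_mul_diagonal hR.1
  have hUu : IsUnit U := IsUnit.of_mul_eq_one _ hU
  have hd : ∀ i, 0 ≤ d i := by
    intro i
    rw [hRU] at hR
    have := (hUu.posSemidef_star_right_conjugate_iff).1 hR
    exact Complex.zero_le_real.1 (posSemidef_diagonal_iff.1 this i)
  set s : n → ℝ := fun i => if d i = 0 then 1 else √(d i) with hs
  have hs0 : ∀ i, (s i : ℂ) ≠ 0 := by
    intro i
    rw [Complex.ofReal_ne_zero]
    by_cases h : d i = 0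
    · simp [hs, h]
    · simp [hs, h, Real.sqrt_ne_zero (hd i)]
  set S' : Matrix n n ℂ := diagonal (fun i => (s i : ℂ)⁻¹) * Uᴴ with hS'
  set S : Matrix n n ℂ := U * diagonal (fun i => (s i : ℂ)) with hS
  have hUU : Uᴴ * U = 1 := mul_eq_one_comm.1 hU
  have hSS' : S * S' = 1 := by
    rw [hS, hS', Matrix.mul_assoc, ← Matrix.mul_assoc (diagonal _), diagonal_mul_diagonal]
    simp [hs0, hU]
  have hback : ∀ A : Matrix n n ℂ, A = S * (S' * A * S'ᴴ) * Sᴴ := by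
    intro A
    have h2 : S'ᴴ * Sᴴ = 1 := by rw [← conjTranspose_mul, hSS', conjTranspose_one]
    calc A = (S * S') * A * (S'ᴴ * Sᴴ) := by rw [hSS', h2, Matrix.one_mul, Matrix.mul_one]
      _ = _ := by simp only [Matrix.mul_assoc]
  have hsum : S' * P * S'ᴴ + S' * Q * S'ᴴ = diagonal fun i => if d i = 0 then 0 else 1 := by
    rw [← Matrix.add_mul, ← Matrix.mul_add, hRU, hS', conjTranspose_mul, conjTranspose_conjTranspose,
      diagonal_conjTranspose]
    have : ∀ D E F : Matrix n n ℂ, D * Uᴴ * (U * E * Uᴴ) * (U * F) = D * E * F := by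
      intro D E F
      calc D * Uᴴ * (U * E * Uᴴ) * (U * F) = D * (Uᴴ * U) * E * (Uᴴ * U) * F := by
            simp only [Matrix.mul_assoc]
        _ = _ := by rw [hUU, Matrix.mul_one, Matrix.mul_one]
    rw [this, diagonal_mul_diagonal, diagonal_mul_diagonal]
    congr 1
    ext i
    by_cases h : d i = 0
    · simp [h]
    · have h3 : (d i : ℂ) = (s i : ℂ) * s i := by
        rw [← Complex.ofReal_mul]
        simp [hs, h, Real.mul_self_sqrt (hd i)]
      have h4 := hs0 i
      simp only [h, if_false, Pi.star_apply, star_inv₀, Complex.star_def, Complex.conj_ofReal]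
      rw [h3]
      field_simp
  obtain ⟨T, p, q, hT, hPT, hQT⟩ := diagonalize_pair_of_add_eq
    (hP.mul_mul_conjTranspose_same S') (hQ.mul_mul_conjTranspose_same S') (fun i => d i = 0) hsum
  refine ⟨S * T, p, q, (IsUnit.of_mul_eq_one _ hSS').mul hT, ?_, ?_⟩
  · rw [hback P, hPT, conjTranspose_mul S T]
    simp only [Matrix.mul_assoc]
  · rw [hback Q, hQT, conjTranspose_mul S T]
    simp only [Matrix.mul_assoc]

/-! ### The sector of a pair of unimodular numbers -/

/-- For `θ ∈ [α, β]` the coefficients are nonnegative. -/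
theorem exp_eq_comb {α β : ℝ} (hδ : 0 < Real.sin (β - α)) (θ : ℝ) :
    Complex.exp (θ * Complex.I) =
      ((Real.sin (β - θ) / Real.sin (β - α) : ℝ) : ℂ) * Complex.exp (α * Complex.I) +
      ((Real.sin (θ - α) / Real.sin (β - α) : ℝ) : ℂ) * Complex.exp (β * Complex.I) := by
  have h0 := hδ.ne'
  apply Complex.ext
  · simp only [Complex.add_re, Complex.re_ofReal_mul, Complex.exp_ofReal_mul_I_re]
    field_simp
    rw [Real.sin_sub, Real.sin_sub, Real.sin_sub]
    ring
  · simp only [Complex.add_im, Complex.im_ofReal_mul, Complex.exp_ofReal_mul_I_im]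
    field_simp
    rw [Real.sin_sub, Real.sin_sub, Real.sin_sub]
    ring

/-- The nonzero elements of the cone spanned by `e^{iα}` and `e^{iβ}` have an argument in `[α, β]`. -/
theorem exists_polar_of_comb {α β : ℝ} (hαβ : 0 < β - α) (hαβπ : β - α < Real.pi) {p q : ℝ}
    (hp : 0 ≤ p) (hq : 0 ≤ q) (h : ¬ (p = 0 ∧ q = 0)) :
    ∃ r θ : ℝ, 0 < r ∧ θ ∈ Set.Icc α β ∧
      Complex.exp (α * Complex.I) * p + Complex.exp (β * Complex.I) * q =
        r * Complex.exp (θ * Complex.I) := by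
  set δ := β - α with hδ
  have hsin : 0 < Real.sin δ := Real.sin_pos_of_pos_of_lt_pi hαβ hαβπ
  set z : ℂ := p + Complex.exp (δ * Complex.I) * q with hz
  have hzre : z.re = p + Real.cos δ * q := by
    simp [hz, Complex.exp_ofReal_mul_I_re]
  have hzim : z.im = Real.sin δ * q := by
    simp [hz, Complex.exp_ofReal_mul_I_im]
  have hz0 : z ≠ 0 := by
    intro h0
    have h1 : Real.sin δ * q = 0 := by rw [← hzim, h0, Complex.zero_im]
    have h2 : q = 0 := (mul_eq_zero.1 h1).resolve_left hsin.ne'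
    have h3 : p + Real.cos δ * q = 0 := by rw [← hzre, h0, Complex.zero_re]
    exact h ⟨by simpa [h2] using h3, h2⟩
  have hr : 0 < ‖z‖ := norm_pos_iff.2 hz0
  have harg0 : 0 ≤ z.arg := Complex.arg_nonneg_iff.2 (by rw [hzim]; positivity)
  have hargδ : z.arg ≤ δ := by
    by_contra! hlt
    have hpos : 0 < Real.sin (z.arg - δ) :=
      Real.sin_pos_of_pos_of_lt_pi (by linarith) (by linarith [Complex.arg_le_pi z])
    have h1 : ‖z‖ * Real.sin (z.arg - δ) = - (p * Real.sin δ) := by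
      rw [Real.sin_sub, mul_sub, ← mul_assoc, ← mul_assoc, Complex.norm_mul_sin_arg,
        Complex.norm_mul_cos_arg, hzre, hzim]
      ring
    have h2 : 0 < ‖z‖ * Real.sin (z.arg - δ) := mul_pos hr hpos
    have h3 : 0 ≤ p * Real.sin δ := mul_nonneg hp hsin.le
    linarith
  refine ⟨‖z‖, α + z.arg, hr, ⟨by linarith, by linarith⟩, ?_⟩
  have h1 : Complex.exp ((α + z.arg : ℝ) * Complex.I) =
      Complex.exp (α * Complex.I) * Complex.exp (z.arg * Complex.I) := by
    rw [← Complex.exp_add]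
    congr 1
    push_cast
    ring
  have h2 : Complex.exp (β * Complex.I) =
      Complex.exp (α * Complex.I) * Complex.exp (δ * Complex.I) := by
    rw [← Complex.exp_add]
    congr 1
    rw [hδ]
    push_cast
    ring
  rw [h1, h2, mul_left_comm, Complex.norm_mul_exp_arg_mul_I, hz]
  ring

/-! ### Phase bounds and pairs of positive semidefinite matrices -/

theorem canonicalForm_zero (k l : ℕ) (a : Fin l → ℝ) (γ : ℝ) :
    canonicalForm k l 0 a γ = diagonal (Sum.elim (fun _ => 0)
      (Sum.elim (fun j => Complex.exp (a j * Complex.I)) fun _ => 0)) := by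
  ext (i | i | i) (j | j | j)
  all_goals first
    | exact isEmptyElim i
    | exact isEmptyElim j
    | simp [canonicalForm, diagonal_apply]

/-- A combination of positive semidefinite matrices with coefficients `e^{iα}` and `e^{iβ}` has its numerical range in a half-plane bounded by a line through the origin. -/
theorem isSemisectorial_of_comb {n : Type*} [Fintype n] {α β : ℝ} (hδ : 0 < Real.sin (β - α))
    {P Q : Matrix n n ℂ} (hP : P.PosSemidef) (hQ : Q.PosSemidef) :
    IsSemisectorial (Complex.exp (α * Complex.I) • P + Complex.exp (β * Complex.I) • Q) := by
  intro h0
  obtain ⟨ε, hε, hball⟩ := Metric.mem_nhds_iff.1 (mem_interior_iff_mem_nhds.1 h0)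
  -- a point near the origin on the wrong side of the line through `e^{iα}`
  set w : ℂ := -((ε / 2 : ℝ) : ℂ) * Complex.I * Complex.exp (α * Complex.I) with hw
  have hwball : w ∈ Metric.ball (0 : ℂ) ε := by
    rw [mem_ball_zero_iff, hw, norm_mul, norm_mul, norm_neg, Complex.norm_real, Complex.norm_I,
      Complex.norm_exp_ofReal_mul_I, Real.norm_eq_abs, abs_of_pos (half_pos hε)]
    linarith
  obtain ⟨x, -, hx⟩ := hball hwball
  have hp := hP.dotProduct_mulVec_nonneg x
  have hq := hQ.dotProduct_mulVec_nonneg x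
  rw [add_mulVec, smul_mulVec, smul_mulVec, dotProduct_add, dotProduct_smul, dotProduct_smul,
    smul_eq_mul, smul_eq_mul] at hx
  set p := star x ⬝ᵥ (P *ᵥ x) with hpdef
  set q := star x ⬝ᵥ (Q *ᵥ x) with hqdef
  rw [Complex.le_def] at hp hq
  have hpim : p.im = 0 := hp.2.symm
  have hqim : q.im = 0 := hq.2.symm
  have hre := congrArg Complex.re hx
  have him := congrArg Complex.im hx
  simp only [hw, Complex.add_re, Complex.add_im, Complex.mul_re, Complex.mul_im, Complex.neg_re,
    Complex.neg_im, Complex.exp_ofReal_mul_I_re, Complex.exp_ofReal_mul_I_im, hpim, hqim,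
    Complex.ofReal_re, Complex.ofReal_im, Complex.I_re, Complex.I_im] at hre him
  have key : q.re * Real.sin (β - α) = -(ε / 2) := by
    rw [Real.sin_sub]
    have := Real.sin_sq_add_cos_sq α
    linear_combination (Real.cos α) * him - (Real.sin α) * hre - (ε / 2) * this
  have : 0 ≤ q.re * Real.sin (β - α) := mul_nonneg hq.1 hδ.le
  linarith

/-- A matrix is semisectorial with phases in `[α, β]` if and only if it is a combination of two
positive semidefinite matrices with coefficients `e^{iα}` and `e^{iβ}`. -/
theorem isPhaseBounded_iff_exists {n : Type*} [Fintype n] [DecidableEq n] {α β : ℝ}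
    (hαβ : 0 < β - α) (hαβπ : β - α < Real.pi) (C : Matrix n n ℂ) :
    IsPhaseBounded α β C ↔ ∃ P Q : Matrix n n ℂ, P.PosSemidef ∧ Q.PosSemidef ∧
      C = Complex.exp (α * Complex.I) • P + Complex.exp (β * Complex.I) • Q := by
  have hsin : 0 < Real.sin (β - α) := Real.sin_pos_of_pos_of_lt_pi hαβ hαβπ
  constructor
  · rintro ⟨-, s, ⟨⟨k, l, m, a, γ, ⟨e, T, -, hC⟩, rfl⟩, -⟩, hs⟩
    -- the phases `γ ± π/2` are too far apart to lie both in `[α, β]`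
    obtain rfl : m = 0 := by
      by_contra hm
      have h1 := (hs (γ + Real.pi / 2) (by simp [Multiset.mem_replicate, hm])).2
      have h2 := (hs (γ - Real.pi / 2) (by simp [Multiset.mem_replicate, hm])).1
      linarith
    have ha : ∀ j, a j ∈ Set.Icc α β := fun j => hs _ (by simp)
    set p : Fin k ⊕ (Fin l ⊕ (Fin 2 × Fin 0)) → ℂ := Sum.elim (fun _ => 0)
      (Sum.elim (fun j => ((Real.sin (β - a j) / Real.sin (β - α) : ℝ) : ℂ)) fun _ => 0) with hp
    set q : Fin k ⊕ (Fin l ⊕ (Fin 2 × Fin 0)) → ℂ := Sum.elim (fun _ => 0)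
      (Sum.elim (fun j => ((Real.sin (a j - α) / Real.sin (β - α) : ℝ) : ℂ)) fun _ => 0) with hq
    have hp0 : (diagonal p).PosSemidef := by
      refine posSemidef_diagonal_iff.2 ?_
      rintro (i | i | i)
      · exact le_rfl
      · exact Complex.zero_le_real.2 (div_nonneg (Real.sin_nonneg_of_nonneg_of_le_pi
          (by linarith [(ha i).2]) (by linarith [(ha i).1])) hsin.le)
      · exact le_rfl
    have hq0 : (diagonal q).PosSemidef := by
      refine posSemidef_diagonal_iff.2 ?_
      rintro (i | i | i)
      · exact le_rfl
      · exact Complex.zero_le_real.2 (div_nonneg (Real.sin_nonneg_of_nonneg_of_le_pi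
          (by linarith [(ha i).1]) (by linarith [(ha i).2])) hsin.le)
      · exact le_rfl
    have hcan : canonicalForm k l 0 a γ = Complex.exp (α * Complex.I) • diagonal p +
        Complex.exp (β * Complex.I) • diagonal q := by
      rw [canonicalForm_zero, ← diagonal_smul, ← diagonal_smul, diagonal_add]
      congr 1
      funext i
      rcases i with i | i | i
      · simp [hp, hq]
      · simp only [hp, hq, Sum.elim_inr, Sum.elim_inl, Pi.smul_apply, smul_eq_mul]
        rw [exp_eq_comb hsin (a i)]
        ring
      · simp [hp, hq]
    refine ⟨T * (diagonal p).reindex e e * Tᴴ, T * (diagonal q).reindex e e * Tᴴ,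
      (hp0.submatrix e.symm).mul_mul_conjTranspose_same T,
      (hq0.submatrix e.symm).mul_mul_conjTranspose_same T, ?_⟩
    rw [hC, hcan]
    simp only [reindex_apply, submatrix_add, submatrix_smul, Matrix.mul_add, Matrix.add_mul,
      Matrix.mul_smul, Matrix.smul_mul, Pi.add_apply, Pi.smul_apply]
  · rintro ⟨P, Q, hP, hQ, rfl⟩
    refine ⟨isSemisectorial_of_comb hsin hP hQ, ?_⟩
    obtain ⟨T, p, q, hT, hp, hq, hPT, hQT⟩ := PosSemidef.exists_diagonalize_pair hP hQ
    classical
    set z : n → Prop := fun i => p i = 0 ∧ q i = 0 with hz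
    have hpolar : ∀ i, ∃ r θ : ℝ, 0 < r ∧ θ ∈ Set.Icc α β ∧ (¬ z i →
        Complex.exp (α * Complex.I) * p i + Complex.exp (β * Complex.I) * q i =
          r * Complex.exp (θ * Complex.I)) := by
      intro i
      by_cases h : z i
      · exact ⟨1, α, one_pos, ⟨le_rfl, by linarith⟩, fun h' => absurd h h'⟩
      · obtain ⟨r, θ, hr, hθ, h'⟩ := exists_polar_of_comb hαβ hαβπ (hp i) (hq i) h
        exact ⟨r, θ, hr, hθ, fun _ => h'⟩
    choose r θ hr hθ hrθ using hpolar
    -- sort the diagonal entries into the vanishing and the nonvanishing ones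
    set f₀ := (Fintype.equivFin {i // z i}).symm
    set f₁ := (Fintype.equivFin {i // ¬ z i}).symm with hf₁
    set k := Fintype.card {i // z i}
    set l := Fintype.card {i // ¬ z i}
    set e : Fin k ⊕ (Fin l ⊕ (Fin 2 × Fin 0)) ≃ n :=
      (Equiv.sumCongr f₀ ((Equiv.sumEmpty _ _).trans f₁)).trans (Equiv.sumCompl z) with he
    set a : Fin l → ℝ := fun j => θ (f₁ j) with ha
    have hcan : (canonicalForm k l 0 a 0).reindex e e =
        diagonal fun i => if z i then 0 else Complex.exp (θ i * Complex.I) := by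
      rw [canonicalForm_zero, reindex_apply, submatrix_diagonal_equiv]
      congr 1
      funext i
      obtain ⟨x, rfl⟩ := e.surjective i
      rw [Function.comp_apply, Equiv.symm_apply_apply]
      rcases x with x | x | x
      · have h1 : e (Sum.inl x) = (f₀ x : n) := rfl
        rw [h1, if_pos (f₀ x).2]
        rfl
      · have h1 : e (Sum.inr (Sum.inl x)) = (f₁ x : n) := rfl
        rw [h1, if_neg (f₁ x).2]
        rfl
      · exact x.2.elim0
    refine ⟨_, ⟨⟨k, l, 0, a, 0, ⟨e, T * diagonal (fun i => ((√(r i) : ℝ) : ℂ)), ?_, ?_⟩, rfl⟩,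
      α, ?_⟩, ?_⟩
    · refine hT.mul ?_
      rw [Matrix.isUnit_iff_isUnit_det, det_diagonal, isUnit_iff_ne_zero]
      exact Finset.prod_ne_zero_iff.2 fun i _ =>
        Complex.ofReal_ne_zero.2 (Real.sqrt_ne_zero'.2 (hr i))
    · rw [hcan, hPT, hQT, conjTranspose_mul, diagonal_conjTranspose]
      have h1 : (Complex.exp (α * Complex.I) • diagonal (fun i => (p i : ℂ)) +
          Complex.exp (β * Complex.I) • diagonal (fun i => (q i : ℂ)) : Matrix n n ℂ) =
          diagonal (fun i => ((√(r i) : ℝ) : ℂ)) *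
            (diagonal fun i => if z i then 0 else Complex.exp (θ i * Complex.I)) *
            diagonal (star fun i => ((√(r i) : ℝ) : ℂ)) := by
        rw [← diagonal_smul, ← diagonal_smul, diagonal_add, diagonal_mul_diagonal,
          diagonal_mul_diagonal]
        congr 1
        funext i
        by_cases h : z i
        · simp [h, h.1, h.2]
        · have h2 : ((√(r i) : ℝ) : ℂ) * ((√(r i) : ℝ) : ℂ) = r i := by
            rw [← Complex.ofReal_mul, Real.mul_self_sqrt (hr i).le]
          simp only [h, if_false, Pi.smul_apply, smul_eq_mul, hrθ i h, Pi.star_apply,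
            Complex.star_def, Complex.conj_ofReal]
          rw [← h2]
          ring
      calc _ = T * (Complex.exp (α * Complex.I) • diagonal (fun i => (p i : ℂ)) +
          Complex.exp (β * Complex.I) • diagonal (fun i => (q i : ℂ))) * Tᴴ := by
            simp only [Matrix.mul_add, Matrix.add_mul, Matrix.mul_smul, Matrix.smul_mul]
        _ = _ := by
            rw [h1]
            simp only [Matrix.mul_assoc]
    · intro φ hφ
      simp only [Multiset.replicate_zero, add_zero, Multiset.mem_map] at hφ
      obtain ⟨j, -, rfl⟩ := hφ
      exact ⟨(hθ _).1, by linarith [(hθ (f₁ j)).2]⟩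
    · intro φ hφ
      simp only [Multiset.replicate_zero, add_zero, Multiset.mem_map] at hφ
      obtain ⟨j, -, rfl⟩ := hφ
      exact hθ _

/-- The Hermitian matrix `P` of the decomposition `C = a P + b Q` with `P` and `Q` Hermitian, for
complex numbers `a`, `b` that are linearly independent over the reals. -/
noncomputable def sectorPart {n : Type*} (a b : ℂ) (C : Matrix n n ℂ) : Matrix n n ℂ :=
  (a * star b - star a * b)⁻¹ • (star b • C - b • Cᴴ)

theorem sectorPart_apply {n : Type*} (a b : ℂ) (C : Matrix n n ℂ) (i j : n) :
    sectorPart a b C i j =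
      (a * star b - star a * b)⁻¹ * (star b * C i j - b * star (C j i)) := rfl

theorem smul_sectorPart_add {n : Type*} {a b : ℂ} (h : a * star b - star a * b ≠ 0)
    (C : Matrix n n ℂ) : a • sectorPart a b C + b • sectorPart b a C = C := by
  ext i j
  have h' : b * star a - star b * a = -(a * star b - star a * b) := by ring
  simp only [Matrix.add_apply, Matrix.smul_apply, smul_eq_mul, sectorPart_apply, h', inv_neg]
  field_simp
  ring

theorem sectorPart_comb {n : Type*} {a b : ℂ} (h : a * star b - star a * b ≠ 0)
    {P Q : Matrix n n ℂ} (hP : P.IsHermitian) (hQ : Q.IsHermitian) :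
    sectorPart a b (a • P + b • Q) = P := by
  have h1 : star b • (a • P + b • Q) - b • (a • P + b • Q)ᴴ = (a * star b - star a * b) • P := by
    rw [conjTranspose_add, conjTranspose_smul, conjTranspose_smul, hP, hQ]
    module
  rw [sectorPart, h1, smul_smul, inv_mul_cancel₀ h, one_smul]

theorem HasPattern.sectorPart {V : Type*} {G : SimpleGraph V} {C : Matrix V V ℂ}
    (hC : HasPattern G C) (a b : ℂ) : HasPattern G (sectorPart a b C) := by
  intro i j hij
  rw [sectorPart_apply, hC i j hij, hC j i fun h => hij (h.imp Eq.symm fun h => h.symm)]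
  simp

theorem exp_mul_star_sub_ne_zero {α β : ℝ} (h : Real.sin (β - α) ≠ 0) :
    Complex.exp (α * Complex.I) * star (Complex.exp (β * Complex.I)) -
      star (Complex.exp (α * Complex.I)) * Complex.exp (β * Complex.I) ≠ 0 := by
  intro h0
  have him := congrArg Complex.im h0
  simp only [Complex.star_def, Complex.sub_im, Complex.mul_im, Complex.conj_re, Complex.conj_im,
    Complex.exp_ofReal_mul_I_re, Complex.exp_ofReal_mul_I_im, Complex.zero_im] at him
  apply h
  rw [Real.sin_sub]
  linarith

theorem isPhaseBounded_iff_sectorPart {n : Type*} [Fintype n] [DecidableEq n] {α β : ℝ}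
    (hαβ : 0 < β - α) (hαβπ : β - α < Real.pi) (C : Matrix n n ℂ) :
    IsPhaseBounded α β C ↔
      (sectorPart (Complex.exp (α * Complex.I)) (Complex.exp (β * Complex.I)) C).PosSemidef ∧
      (sectorPart (Complex.exp (β * Complex.I)) (Complex.exp (α * Complex.I)) C).PosSemidef := by
  have hsin : 0 < Real.sin (β - α) := Real.sin_pos_of_pos_of_lt_pi hαβ hαβπ
  have hne := exp_mul_star_sub_ne_zero hsin.ne'
  have hne' := exp_mul_star_sub_ne_zero (α := β) (β := α)
    (by rw [← neg_sub, Real.sin_neg]; exact (neg_neg_of_pos hsin).ne)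
  rw [isPhaseBounded_iff_exists hαβ hαβπ]
  constructor
  · rintro ⟨P, Q, hP, hQ, rfl⟩
    refine ⟨?_, ?_⟩
    · rwa [sectorPart_comb hne hP.1 hQ.1]
    · rwa [add_comm, sectorPart_comb hne' hQ.1 hP.1]
  · rintro ⟨hP, hQ⟩
    exact ⟨_, _, hP, hQ, (smul_sectorPart_add hne C).symm⟩

/-! ### Completions and decompositions -/

theorem exists_fin_sum_of_mem_closure {M : Type*} [AddCommMonoid M] {s : Set M} {x : M}
    (hx : x ∈ AddSubmonoid.closure s) :
    ∃ (N : ℕ) (D : Fin N → M), x = ∑ i, D i ∧ ∀ i, D i ∈ s := by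
  obtain ⟨l, hl, rfl⟩ := AddSubmonoid.exists_list_of_mem_closure hx
  exact ⟨l.length, fun i => l[i], (Fin.sum_univ_getElem l).symm, fun i => hl _ (l.getElem_mem i.2)⟩

theorem rank_smul_vecMulVec_star {n : Type*} [Fintype n] {c : ℂ} (hc : c ≠ 0) {x : n → ℂ}
    (hx : x ≠ 0) : (c • vecMulVec x (star x)).rank = 1 := by
  classical
  refine le_antisymm ?_ (Nat.one_le_iff_ne_zero.2 fun h => ?_)
  · rw [← smul_vecMulVec]
    exact rank_vecMulVec_le _ _
  · obtain ⟨i, hi⟩ := Function.ne_iff.1 hx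
    rw [rank, Submodule.finrank_eq_zero, LinearMap.range_eq_bot] at h
    have h' := congrFun (LinearMap.congr_fun h (Pi.single i 1)) i
    rw [mulVecLin_apply, mulVec_single_one] at h'
    simp only [col_apply, Matrix.smul_apply, vecMulVec_apply, Pi.star_apply, smul_eq_mul,
      LinearMap.zero_apply, Pi.zero_apply, mul_eq_zero, star_eq_zero, or_self] at h'
    exact h'.elim hc hi

theorem IsPhaseBounded.sum {n ι : Type*} [Fintype n] [DecidableEq n] [Fintype ι] {α β : ℝ}
    (hαβ : 0 < β - α) (hαβπ : β - α < Real.pi) {D : ι → Matrix n n ℂ}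
    (hD : ∀ i, IsPhaseBounded α β (D i)) : IsPhaseBounded α β (∑ i, D i) := by
  choose P Q hP hQ hPQ using fun i => (isPhaseBounded_iff_exists hαβ hαβπ (D i)).1 (hD i)
  refine (isPhaseBounded_iff_exists hαβ hαβπ _).2 ⟨∑ i, P i, ∑ i, Q i,
    posSemidef_sum _ fun i _ => hP i, posSemidef_sum _ fun i _ => hQ i, ?_⟩
  rw [Finset.smul_sum, Finset.smul_sum, ← Finset.sum_add_distrib]
  exact Finset.sum_congr rfl fun i _ => hPQ i

/-- A matrix with a chordal pattern and with phases in `[α, β]` is a sum of rank-one matrices of the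
same kind supported on cliques. -/
theorem IsPhaseBounded.exists_clique_sum {V : Type*} [Fintype V] [DecidableEq V]
    {G : SimpleGraph V} (hG : IsChordal G) {α β : ℝ} (hαβ : 0 < β - α)
    (hαβπ : β - α < Real.pi) {C : Matrix V V ℂ} (hp : HasPattern G C)
    (hC : IsPhaseBounded α β C) :
    ∃ (N : ℕ) (D : Fin N → Matrix V V ℂ), C = ∑ i, D i ∧
      ∀ i, (D i).rank = 1 ∧ IsPhaseBounded α β (D i) ∧
        ∃ K : Finset V, G.IsClique K ∧ IsSupportedOn K (D i) := by
  refine exists_fin_sum_of_mem_closure (s := {D : Matrix V V ℂ | D.rank = 1 ∧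
    IsPhaseBounded α β D ∧ ∃ K : Finset V, G.IsClique K ∧ IsSupportedOn K D}) ?_
  -- multiplication by `c = e^{iα}` or `c = e^{iβ}` takes each `x x*` to a summand as required
  have key : ∀ (c : ℂ) (A : Matrix V V ℂ), c ≠ 0 →
      (∀ x : V → ℂ, IsPhaseBounded α β (c • vecMulVec x (star x))) → A.PosSemidef →
      HasPattern G A → c • A ∈ AddSubmonoid.closure {D : Matrix V V ℂ | D.rank = 1 ∧
        IsPhaseBounded α β D ∧ ∃ K : Finset V, G.IsClique K ∧ IsSupportedOn K D} := by
    intro c A hc hcx hA hAp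
    have hmem := hG.posSemidef_mem_closure Finset.univ A hA hAp fun i j h => absurd (by simp) h
    clear hA hAp
    induction hmem using AddSubmonoid.closure_induction with
    | mem D hD =>
      obtain ⟨K, hK, x, hx, hxK, rfl⟩ := hD
      refine AddSubmonoid.subset_closure ⟨rank_smul_vecMulVec_star hc hx, hcx x, K, hK, ?_⟩
      intro i j hij
      by_cases hi : i ∈ K
      · simp [vecMulVec_apply, hxK j fun hj => hij ⟨hi, hj⟩]
      · simp [vecMulVec_apply, hxK i hi]
    | zero =>
      rw [smul_zero]
      exact zero_mem _
    | add D E _ _ hD hE =>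
      rw [smul_add]
      exact add_mem hD hE
  have hparts := (isPhaseBounded_iff_sectorPart hαβ hαβπ C).1 hC
  have hne := exp_mul_star_sub_ne_zero (Real.sin_pos_of_pos_of_lt_pi hαβ hαβπ).ne'
  rw [← smul_sectorPart_add hne C]
  refine add_mem (key _ _ (Complex.exp_ne_zero _) (fun x => ?_) hparts.1 (hp.sectorPart _ _))
    (key _ _ (Complex.exp_ne_zero _) (fun x => ?_) hparts.2 (hp.sectorPart _ _))
  · exact (isPhaseBounded_iff_exists hαβ hαβπ _).2
      ⟨_, 0, posSemidef_vecMulVec_self_star x, PosSemidef.zero, by simp⟩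
  · exact (isPhaseBounded_iff_exists hαβ hαβπ _).2
      ⟨0, _, PosSemidef.zero, posSemidef_vecMulVec_self_star x, by simp⟩

/-- The completion criterion. Passing to a principal submatrix commutes with taking the parts of a
matrix along `e^{iα}` and `e^{iβ}`, so the two parts of a partial matrix are completed separately. -/
theorem exists_completion_iff {V : Type*} [Fintype V] [DecidableEq V]
    {G : SimpleGraph V} (hG : IsChordal G) {α β : ℝ} (hαβ : 0 < β - α)
    (hαβπ : β - α < Real.pi) (C : PartialMatrix G) :
    (∃ M : Matrix V V ℂ, C.IsCompletion M ∧ IsPhaseBounded α β M) ↔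
      ∀ (K : Finset V) (hK : G.IsClique K), IsPhaseBounded α β (C.principal hK) := by
  classical
  have hne := exp_mul_star_sub_ne_zero (Real.sin_pos_of_pos_of_lt_pi hαβ hαβπ).ne'
  simp only [isPhaseBounded_iff_exists hαβ hαβπ]
  constructor
  · rintro ⟨M, hM, P, Q, hP, hQ, rfl⟩ K hK
    refine ⟨_, _, hP.submatrix ((↑) : K → V), hQ.submatrix ((↑) : K → V), ?_⟩
    ext i j
    exact (hM i j (clique_pos hK i j)).symm
  · intro h
    set a := Complex.exp (α * Complex.I)
    set b := Complex.exp (β * Complex.I)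
    set C₀ : Matrix V V ℂ := fun i j => if h : i = j ∨ G.Adj i j then C i j h else 0 with hC₀
    have hparts : ∀ (K : Finset V) (hK : G.IsClique K),
        ((sectorPart a b C₀).submatrix ((↑) : K → V) ((↑) : K → V)).PosSemidef ∧
        ((sectorPart b a C₀).submatrix ((↑) : K → V) ((↑) : K → V)).PosSemidef := by
      intro K hK
      have hsub : ∀ c d : ℂ, (sectorPart c d C₀).submatrix ((↑) : K → V) ((↑) : K → V) =
          sectorPart c d (C.principal hK) := by
        intro c d
        ext i j
        rw [submatrix_apply, sectorPart_apply, sectorPart_apply]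
        simp only [hC₀, dif_pos (clique_pos hK i j), dif_pos (clique_pos hK j i)]
        rfl
      rw [hsub, hsub]
      exact (isPhaseBounded_iff_sectorPart hαβ hαβπ _).1
        ((isPhaseBounded_iff_exists hαβ hαβπ _).2 (h K hK))
    obtain ⟨M₁, hM₁, -, hMP₁⟩ :=
      hG.exists_posSemidef_completion_on (fun K hK => (hparts K hK).1) Finset.univ
    obtain ⟨M₂, hM₂, -, hMP₂⟩ :=
      hG.exists_posSemidef_completion_on (fun K hK => (hparts K hK).2) Finset.univ
    refine ⟨a • M₁ + b • M₂, fun i j hij => ?_, M₁, M₂, hM₁, hM₂, rfl⟩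
    -- on the pattern, the entries of `M₁` and `M₂` are those of the two parts of `C₀`
    have h1 := congrFun (congrFun (smul_sectorPart_add hne C₀) i) j
    rw [Matrix.add_apply, Matrix.smul_apply, Matrix.smul_apply] at h1 ⊢
    rw [hMP₁ i (Finset.mem_univ _) j (Finset.mem_univ _) hij,
      hMP₂ i (Finset.mem_univ _) j (Finset.mem_univ _) hij, h1]
    simp only [hC₀, dif_pos hij]

end MatrixPhase

theorem mainTheorem2 {V : Type*} [Fintype V] [DecidableEq V] (G : SimpleGraph V)
    (hG : MatrixPhase.IsChordal G) (α β : ℝ) (hαβ : 0 < β - α) (hαβπ : β - α < Real.pi) :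
    (∀ C : MatrixPhase.PartialMatrix G,
      (∃ M : Matrix V V ℂ, C.IsCompletion M ∧ MatrixPhase.IsPhaseBounded α β M) ↔
        ∀ (K : Finset V) (hK : G.IsClique K),
          MatrixPhase.IsPhaseBounded α β (C.principal hK)) ∧
    (∀ C : Matrix V V ℂ, MatrixPhase.HasPattern G C →
      List.TFAE [
        MatrixPhase.IsPhaseBounded α β C,
        ∃ (N : ℕ) (D : Fin N → Matrix V V ℂ), C = ∑ i, D i ∧
          ∀ i, (D i).rank = 1 ∧ MatrixPhase.IsPhaseBounded α β (D i),
        ∃ (N : ℕ) (D : Fin N → Matrix V V ℂ), C = ∑ i, D i ∧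
          ∀ i, (D i).rank = 1 ∧ MatrixPhase.IsPhaseBounded α β (D i) ∧
            MatrixPhase.HasPattern G (D i),
        ∃ (N : ℕ) (D : Fin N → Matrix V V ℂ), C = ∑ i, D i ∧
          ∀ i, (D i).rank = 1 ∧ MatrixPhase.IsPhaseBounded α β (D i) ∧
            ∃ K : Finset V, G.IsClique K ∧ MatrixPhase.IsSupportedOn K (D i)]) := by
  refine ⟨MatrixPhase.exists_completion_iff hG hαβ hαβπ, fun C hC => ?_⟩
  tfae_have 1 → 4 := fun h => h.exists_clique_sum hG hαβ hαβπ hC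
  tfae_have 4 → 3 := by
    rintro ⟨N, D, hCD, hD⟩
    refine ⟨N, D, hCD, fun i => ⟨(hD i).1, (hD i).2.1, fun j k hjk => ?_⟩⟩
    obtain ⟨K, hK, hs⟩ := (hD i).2.2
    exact hs j k fun h => hjk (MatrixPhase.clique_pos hK ⟨j, h.1⟩ ⟨k, h.2⟩)
  tfae_have 3 → 2 := by
    rintro ⟨N, D, hCD, hD⟩
    exact ⟨N, D, hCD, fun i => ⟨(hD i).1, (hD i).2.1⟩⟩
  tfae_have 2 → 1 := by
    rintro ⟨N, D, rfl, hD⟩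
    exact MatrixPhase.IsPhaseBounded.sum hαβ hαβπ fun i => (hD i).2
  tfae_finish
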